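/- Let $a\ge b>0$ be real numbers and $c=c_1+ic_2\in\mathbb C$ ($c_1,c_2\in\mathbb R$). For an integer $\xi> b$ put $$q(\xi)=1+\frac{a^2-b^2}{\xi^2+\xi\sqrt{\xi^2+a^2-b^2}},$$ $$B(\xi)=2e^{c_1}\,\frac{\xi+\sqrt{\xi^2+a^2-b^2}}{\xi+\sqrt{\xi^2+a^2-b^2}-(a+b)}\left(\frac{a+b}{\xi}\,\frac{e^{q(\xi)}}{1+\sqrt{1+(a^2-b^2)/\xi^2}}\right)^{\xi}.$$ Let $\beta,\gamma\ge 1$ be integers and let $A\in\mathbb C^{n\times n}$ be banded with upper bandwidth $\beta$ and lower bandwidth $\gamma$, i.e. $A_{k,\ell}=0$ whenever $\ell-k>\beta$ or $k-\ell>\gamma$. Suppose that the field of values $W(A)=\{v^*Av : v\in\mathbb C^n,\ \|v\|_2=1\}$ is contained in a compact set $E\subset\mathbb C$ whose boundary is the horizontal ellipse with center $c$, horizontal semi-axis $a$ and vertical semi-axis $b$. For indices $k,\ell$ let $\xi=\lceil(\ell-k)/\beta\rceil$ if $k<\ell$ and $\xi=\lceil(k-\ell)/\gamma\rceil$ if $k\ge\ell$.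 Then, for all $k,\ell$ such that $\xi>b$, $$\left|(e^A)_{k,\ell}\right|\le B(\xi).$$ Moreover, as $\xi\to\infty$ through the integers, the bound decays super-exponentially, like $((a+b)/(2\xi))^\xi$ up to the geometric factor $e^\xi$: one has $$B(\xi)\sim 2e^{c_1}\left(e\,\frac{a+b}{2\xi}\right)^{\xi},$$ and $B(\xi)=o(r^\xi)$ for every $r>0$. -/

import Mathlib

open scoped Matrix

/-- `A ∈ 𝓑ₙ(β, γ)`: upper bandwidth `β` and lower bandwidth `γ`, that is,
`A k l = 0` whenever `l - k > β` or `k - l > γ`. -/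
def IsBandedMatrix {n : ℕ} (β γ : ℕ) (A : Matrix (Fin n) (Fin n) ℂ) : Prop :=
  ∀ k l : Fin n,
    ((β : ℤ) < (l : ℤ) - (k : ℤ) ∨ (γ : ℤ) < (k : ℤ) - (l : ℤ)) → A k l = 0

/-- The field of values `W(A) = {v* A v | ‖v‖ = 1}`, with the Euclidean norm on `ℂⁿ`. -/
def fieldOfValues {n : ℕ} (A : Matrix (Fin n) (Fin n) ℂ) : Set ℂ :=
  {z | ∃ v : EuclideanSpace ℂ (Fin n), ‖v‖ = 1 ∧ star v.ofLp ⬝ᵥ (A *ᵥ v.ofLp) = z}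

/-- The horizontal ellipse (the curve) with semi-axes `a`, `b` and center `c`. -/
def horizontalEllipse (a b : ℝ) (c : ℂ) : Set ℂ :=
  {z | ((z.re - c.re) / a) ^ 2 + ((z.im - c.im) / b) ^ 2 = 1}

/-- The index `ξ`: `⌈(l - k) / β⌉` above the diagonal and `⌈(k - l) / γ⌉` elsewhere. -/
noncomputable def bandIndex {n : ℕ} (β γ : ℕ) (k l : Fin n) : ℕ :=
  if k < l then ⌈((l : ℝ) - (k : ℝ)) / (β : ℝ)⌉₊ else ⌈((k : ℝ) - (l : ℝ)) / (γ : ℝ)⌉₊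

/-- `q(ξ) = 1 + (a² - b²) / (ξ² + ξ √(ξ² + a² - b²))`. -/
noncomputable def ellipseQ (a b x : ℝ) : ℝ :=
  1 + (a ^ 2 - b ^ 2) / (x ^ 2 + x * √(x ^ 2 + a ^ 2 - b ^ 2))

/-- The explicit bound as a function of `ξ`; `c₁` is the real part of the center. -/
noncomputable def expDecayBound (a b c₁ : ℝ) (ξ : ℕ) : ℝ :=
  2 * Real.exp c₁ *
    (((ξ : ℝ) + √((ξ : ℝ) ^ 2 + a ^ 2 - b ^ 2)) /
      ((ξ : ℝ) + √((ξ : ℝ) ^ 2 + a ^ 2 - b ^ 2) - (a + b))) *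
    ((a + b) / (ξ : ℝ) *
      (Real.exp (ellipseQ a b ξ) / (1 + √(1 + (a ^ 2 - b ^ 2) / (ξ : ℝ) ^ 2)))) ^ ξ

/-! Put `s = (a+b)/2`, `κ = (a-b)/(a+b)`, `M = (A - c)/s`. Then `W(M)` lies in the image of the unit
disk under `w ↦ w + κ w̄`, an ellipse whose Faber polynomials `F_j` obey `F_{j+2} = M F_{j+1} - κ
F_j`. Their generating function `H(z) = (1 - κz²)(1 + κz² - zM)⁻¹ = 1 + ∑_{j≥1} z^j F_j(M)` has
nonnegative real part on the unit disk, and a Carathéodory-type estimate gives `|F_j(M)_{kl}| ≤ 2`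
for `j ≥ 1` (`norm_faberMatrix_apply_le`). Since `F_j` has degree `j`, bandedness makes this entry
vanish for `j < ξ`. Powers of `M` are nonnegative combinations of the `F_j(M)`, so for `τ ≥ 1` a
majorant argument yields `|(M^i)_{kl}| ≤ 2 τ^{-ξ} (τ + κ/τ)^i` (`norm_pow_apply_le`). Summing the
exponential series gives `|(e^A)_{kl}| ≤ 2 e^{c₁} τ^{-ξ} e^{s(τ + κ/τ)}`. The optimal `τ` produces
`B(ξ)` without its rational prefactor, which is at least 1. The asymptotics rest on `√(ξ² + a² - b²)
- ξ → 0`. -/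

/-! ### Coefficients of functions with positive real part -/

/-- Coefficient estimate of Carathéodory type for the off-diagonal entry `f` of a matrix valued
function with positive real part, whose diagonal entries are `p` and `q`. -/
theorem norm_coeff_le_two_of_re_bound {f g p q R : ℂ → ℂ} {d : ℕ → ℂ} {j : ℕ} (hj : 0 < j)
    (hg : DifferentiableOn ℂ g (Metric.ball 0 1)) (hp : DifferentiableOn ℂ p (Metric.ball 0 1))
    (hq : DifferentiableOn ℂ q (Metric.ball 0 1)) (hR : DifferentiableOn ℂ R (Metric.ball 0 1))
    (hp0 : p 0 = 1) (hq0 : q 0 = 1)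
    (hf : ∀ z ∈ Metric.ball (0 : ℂ) 1, f z = ∑ i ∈ Finset.range j, d i * z ^ i + z ^ j * R z)
    (hb : ∀ z ∈ Metric.ball (0 : ℂ) 1, ‖f z + star (g z)‖ ≤ (p z).re + (q z).re) :
    ‖R 0‖ ≤ 2 := by
  have mv : ∀ {h : ℂ → ℂ} {r : ℝ}, DifferentiableOn ℂ h (Metric.ball 0 1) → 0 < r → r < 1 →
      Real.circleAverage h 0 r = h 0 ∧ CircleIntegrable h 0 r := by
    intro h r hh h0 h1
    have hsub : Metric.closedBall (0 : ℂ) r ⊆ Metric.ball 0 1 := Metric.closedBall_subset_ball h1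
    refine ⟨DiffContOnCl.circleAverage ?_, ContinuousOn.circleIntegrable h0.le
      (hh.continuousOn.mono (Metric.sphere_subset_closedBall.trans hsub))⟩
    rw [abs_of_pos h0]
    exact (hh.mono (Metric.closure_ball_subset_closedBall.trans hsub)).diffContOnCl
  have key : ∀ r : ℝ, 0 < r → r < 1 → ‖R 0‖ * r ^ j ≤ 2 := by
    intro r h0 h1
    -- On `|z| = r` one has `z̄ z = r²`, so after multiplication by `z̄^j` everything except `r^{2j}
    -- R` is the conjugate of the holomorphic `G`. As `G 0 = 0` (this needs `j > 0`), averaging over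
    -- the circle isolates `r^{2j} R 0`.
    set G : ℂ → ℂ := fun z =>
      z ^ j * g z + ∑ i ∈ Finset.range j, star (d i) * (r : ℂ) ^ (2 * i) * z ^ (j - i) with hG
    have hGd : DifferentiableOn ℂ G (Metric.ball 0 1) := by
      rw [hG]; fun_prop
    have hG0 : G 0 = 0 := by
      simp only [hG, zero_pow hj.ne', zero_mul, zero_add]
      refine Finset.sum_eq_zero fun i hi => ?_
      rw [zero_pow (by have := Finset.mem_range.1 hi; omega), mul_zero]
    have hid : ∀ z ∈ Metric.sphere (0 : ℂ) |r|,
        star z ^ j * (f z + star (g z)) = (r : ℂ) ^ (2 * j) • R z + star (G z) := by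
      intro z hz
      rw [abs_of_pos h0] at hz
      have hzn : ‖z‖ = r := by simpa using hz
      have hzz : star z * z = (r : ℂ) ^ 2 := by
        rw [← hzn]; exact Complex.conj_mul' z
      have hzp : ∀ i, star z ^ i * z ^ i = (r : ℂ) ^ (2 * i) := by
        intro i; rw [← mul_pow, hzz, pow_mul]
      have hrs : star (r : ℂ) = r := Complex.conj_ofReal r
      rw [hf z (by simpa [hzn] using h1), hG]
      simp only [star_add, star_mul', star_sum, star_pow, star_star, hrs, smul_eq_mul]
      rw [← hzp j, mul_add, mul_add, Finset.mul_sum]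
      have : ∑ i ∈ Finset.range j, star z ^ j * (d i * z ^ i) =
          ∑ i ∈ Finset.range j, d i * (r : ℂ) ^ (2 * i) * star z ^ (j - i) := by
        refine Finset.sum_congr rfl fun i hi => ?_
        have hij : j = (j - i) + i := by have := Finset.mem_range.1 hi; omega
        rw [← hzp i]
        conv_lhs => rw [hij, pow_add]
        ring
      rw [this]; ring
    have havg : Real.circleAverage (fun z => star z ^ j * (f z + star (g z))) 0 r =
        (r : ℂ) ^ (2 * j) * R 0 := by
      rw [Real.circleAverage_congr_sphere hid]
      obtain ⟨hR1, hR2⟩ := mv hR h0 h1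
      obtain ⟨hG1, hG2⟩ := mv hGd h0 h1
      have hGs : CircleIntegrable (fun z => star (G z)) 0 r := by
        refine ContinuousOn.circleIntegrable h0.le ?_
        exact (hGd.continuousOn.mono (Metric.sphere_subset_closedBall.trans
          (Metric.closedBall_subset_ball h1))).star
      have hRs : CircleIntegrable (fun z => (r : ℂ) ^ (2 * j) • R z) 0 r := hR2.const_smul
      rw [Real.circleAverage_fun_add hRs hGs, Real.circleAverage_fun_smul, hR1]
      have := ContinuousLinearMap.circleAverage_comp_comm (Complex.conjCLE : ℂ →L[ℝ] ℂ) hG2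
      have h2 : Real.circleAverage (fun z => star (G z)) 0 r = star (Real.circleAverage G 0 r) :=
        this
      rw [h2, hG1, hG0]; simp
    have hbd : ‖Real.circleAverage (fun z => star z ^ j * (f z + star (g z))) 0 r‖ ≤
        Real.circleAverage (fun z => r ^ j * ((p z).re + (q z).re)) 0 r := by
      have hc : CircleIntegrable (fun z => r ^ j * ((p z).re + (q z).re)) 0 r := by
        refine ContinuousOn.circleIntegrable h0.le (ContinuousOn.mono ?_
          (Metric.sphere_subset_closedBall.trans (Metric.closedBall_subset_ball h1)))
        exact continuousOn_const.mul ((Complex.continuous_re.comp_continuousOn hp.continuousOn).add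
          (Complex.continuous_re.comp_continuousOn hq.continuousOn))
      rw [Real.circleAverage, Real.circleAverage, norm_smul, smul_eq_mul, Real.norm_eq_abs,
        abs_of_pos (inv_pos.2 Real.two_pi_pos)]
      refine mul_le_mul_of_nonneg_left ?_ (inv_pos.2 Real.two_pi_pos).le
      refine intervalIntegral.norm_integral_le_of_norm_le Real.two_pi_pos.le
        (Filter.Eventually.of_forall fun t _ => ?_) hc
      have hn : ‖circleMap 0 r t‖ = r := by simp [abs_of_pos h0]
      rw [norm_mul, norm_pow, norm_star, hn]
      exact mul_le_mul_of_nonneg_left (hb _ (by simpa [abs_of_pos h0] using h1)) (by positivity)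
    have hre : Real.circleAverage (fun z => r ^ j * ((p z).re + (q z).re)) 0 r = 2 * r ^ j := by
      obtain ⟨hpq1, hpq2⟩ := mv (hp.add hq) h0 h1
      have h2 : Real.circleAverage (fun z => (p z).re + (q z).re) 0 r =
          (Real.circleAverage (p + q) 0 r).re :=
        ContinuousLinearMap.circleAverage_comp_comm Complex.reCLM hpq2
      have h3 := Real.circleAverage_fun_smul (a := r ^ j)
        (f := fun z => (p z).re + (q z).re) (c := 0) (R := r)
      simp only [smul_eq_mul] at h3
      rw [h3, h2, hpq1, Pi.add_apply, hp0, hq0]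
      norm_num
      ring
    rw [havg, hre, norm_mul, norm_pow, Complex.norm_real, Real.norm_eq_abs, abs_of_pos h0] at hbd
    have hrj : 0 < r ^ j := pow_pos h0 j
    rw [two_mul j, pow_add] at hbd
    refine le_of_mul_le_mul_right ?_ hrj
    linarith
  have hlim : Filter.Tendsto (fun r : ℝ => ‖R 0‖ * r ^ j) (nhdsWithin 1 (Set.Iio 1))
      (nhds (‖R 0‖ * 1 ^ j)) :=
    Filter.Tendsto.mono_left (Continuous.tendsto (by fun_prop) 1) nhdsWithin_le_nhds
  rw [one_pow, mul_one] at hlim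
  refine le_of_tendsto hlim ?_
  filter_upwards [Ioo_mem_nhdsLT (show (0 : ℝ) < 1 by norm_num)] with r hr
  exact key r hr.1 hr.2

/-! ### Faber polynomials and positivity of their generating function -/

/-- The Faber polynomials of the ellipse `{z + κ / z : |z| = 1}`, evaluated at a matrix; the
zeroth one is normalized to `2`. -/
def faberMatrix {ι : Type*} [Fintype ι] [DecidableEq ι] (κ : ℝ) (M : Matrix ι ι ℂ) :
    ℕ → Matrix ι ι ℂ
  | 0 => 2
  | 1 => M
  | j + 2 => M * faberMatrix κ M (j + 1) - (κ : ℂ) • faberMatrix κ M j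

/-- The denominator of the generating function of the Faber polynomials. -/
def faberDenom {ι : Type*} [DecidableEq ι] (κ : ℝ) (M : Matrix ι ι ℂ) (z : ℂ) : Matrix ι ι ℂ :=
  (1 + (κ : ℂ) * z ^ 2) • 1 - z • M

/-- The real part is affine in `Re(zw)` and `Re(z w̄)`. Both are at most `r = ‖z‖` and enter with
nonpositive coefficients; replacing them by `r` leaves exactly `(1 - r)(1 - κr)(1 - κr²)`. -/
theorem re_ellipse_form_pos {κ : ℝ} (h0 : 0 ≤ κ) (h1 : κ < 1) {z w : ℂ} (hz : ‖z‖ < 1)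
    (hw : ‖w‖ ≤ 1) :
    0 < (star (1 - (κ : ℂ) * z ^ 2) * (1 + (κ : ℂ) * z ^ 2 - z * (w + κ * star w))).re := by
  set r := ‖z‖ with hr
  have hr0 : 0 ≤ r := norm_nonneg z
  have hsq : r ^ 2 = z.re ^ 2 + z.im ^ 2 := by
    rw [hr, ← Complex.normSq_eq_norm_sq, Complex.normSq_apply]; ring
  have e1 : (z * w).re ≤ r := (Complex.re_le_norm _).trans (by
    rw [norm_mul]; exact mul_le_of_le_one_right hr0 hw)
  have e2 : (z * star w).re ≤ r := (Complex.re_le_norm _).trans (by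
    rw [norm_mul, norm_star]; exact mul_le_of_le_one_right hr0 hw)
  have hid : (star (1 - (κ : ℂ) * z ^ 2) * (1 + (κ : ℂ) * z ^ 2 - z * (w + κ * star w))).re =
      1 - κ ^ 2 * r ^ 4 - ((z * w).re * (1 - κ ^ 2 * r ^ 2) +
        κ * (1 - r ^ 2) * (z * star w).re) := by
    have h4 : r ^ 4 = (z.re ^ 2 + z.im ^ 2) ^ 2 := by rw [← hsq]; ring
    rw [h4, hsq]
    simp [pow_two]
    ring
  rw [hid]
  have hk2 : κ ^ 2 * r ^ 2 ≤ 1 := by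
    rw [← mul_pow]
    exact pow_le_one₀ (by positivity) (mul_le_one₀ h1.le hr0 hz.le)
  have hr2 : r ^ 2 ≤ 1 := pow_le_one₀ hr0 hz.le
  have b1 := mul_le_mul_of_nonneg_right e1 (sub_nonneg.2 hk2)
  have b2 := mul_le_mul_of_nonneg_left e2 (mul_nonneg h0 (sub_nonneg.2 hr2))
  have hpos : 0 < (1 - r) * (1 - κ * r) * (1 - κ * r ^ 2) := by
    have : κ * r < 1 := by nlinarith
    have : κ * r ^ 2 < 1 := by nlinarith
    exact mul_pos (mul_pos (by linarith) (by linarith)) (by linarith)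
  nlinarith

section
variable {ι : Type*} [Fintype ι] [DecidableEq ι] {κ : ℝ} {M : Matrix ι ι ℂ}

/-- The hypothesis is the homogeneous form of the numerical range condition at `y`, which needs no
normalization of `y`. -/
theorem faberDenom_form (κ : ℝ) {z w : ℂ} {y : ι → ℂ}
    (h : star y ⬝ᵥ (M *ᵥ y) = (star y ⬝ᵥ y) * (w + κ * star w)) :
    star y ⬝ᵥ (faberDenom κ M z *ᵥ y) =
      (star y ⬝ᵥ y) * (1 + (κ : ℂ) * z ^ 2 - z * (w + κ * star w)) := by
  rw [faberDenom, Matrix.sub_mulVec, Matrix.smul_mulVec, Matrix.smul_mulVec, Matrix.one_mulVec,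
    dotProduct_sub, dotProduct_smul, dotProduct_smul, h, smul_eq_mul, smul_eq_mul]
  ring

open scoped ComplexOrder in
theorem star_dotProduct_self_pos {ι : Type*} [Fintype ι] {y : ι → ℂ} (hy : y ≠ 0) :
    0 < (star y ⬝ᵥ y).re ∧ (star y ⬝ᵥ y).im = 0 := by
  have := Matrix.dotProduct_star_self_pos_iff.2 hy
  obtain ⟨h1, h2⟩ := Complex.lt_def.1 this
  exact ⟨h1, h2.symm⟩

theorem re_star_mul_faberDenom_form_pos (h0 : 0 ≤ κ) (h1 : κ < 1)
    (hM : ∀ y : ι → ℂ, ∃ w : ℂ, ‖w‖ ≤ 1 ∧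
      star y ⬝ᵥ (M *ᵥ y) = (star y ⬝ᵥ y) * (w + κ * star w))
    {z : ℂ} (hz : ‖z‖ < 1) {y : ι → ℂ} (hy : y ≠ 0) :
    0 < (star (1 - (κ : ℂ) * z ^ 2) * (star y ⬝ᵥ (faberDenom κ M z *ᵥ y))).re := by
  obtain ⟨w, hw, h⟩ := hM y
  obtain ⟨p1, p2⟩ := star_dotProduct_self_pos hy
  rw [faberDenom_form κ h, mul_left_comm, Complex.mul_re, p2, zero_mul, sub_zero]
  exact mul_pos p1 (re_ellipse_form_pos h0 h1 hz hw)

theorem isUnit_det_faberDenom (h0 : 0 ≤ κ) (h1 : κ < 1)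
    (hM : ∀ y : ι → ℂ, ∃ w : ℂ, ‖w‖ ≤ 1 ∧
      star y ⬝ᵥ (M *ᵥ y) = (star y ⬝ᵥ y) * (w + κ * star w))
    {z : ℂ} (hz : ‖z‖ < 1) : IsUnit (faberDenom κ M z).det := by
  rw [isUnit_iff_ne_zero]
  intro hdet
  obtain ⟨y, hy, hPy⟩ := Matrix.exists_mulVec_eq_zero_iff.2 hdet
  have := re_star_mul_faberDenom_form_pos h0 h1 hM hz hy
  simp [hPy] at this

/-- The generating function of the Faber polynomials has nonnegative real part. -/
theorem re_form_generating_nonneg (h0 : 0 ≤ κ) (h1 : κ < 1)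
    (hM : ∀ y : ι → ℂ, ∃ w : ℂ, ‖w‖ ≤ 1 ∧
      star y ⬝ᵥ (M *ᵥ y) = (star y ⬝ᵥ y) * (w + κ * star w))
    {z : ℂ} (hz : ‖z‖ < 1) (x : ι → ℂ) :
    0 ≤ (star x ⬝ᵥ (((1 - (κ : ℂ) * z ^ 2) • (faberDenom κ M z)⁻¹) *ᵥ x)).re := by
  have hu := isUnit_det_faberDenom h0 h1 hM hz
  set y := (faberDenom κ M z)⁻¹ *ᵥ x with hy
  have hx : x = faberDenom κ M z *ᵥ y := by
    rw [hy, Matrix.mulVec_mulVec, Matrix.mul_nonsing_inv _ hu, Matrix.one_mulVec]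
  rw [Matrix.smul_mulVec, ← hy, dotProduct_smul, smul_eq_mul]
  -- With `x = P y`, where `P` is the denominator, the form of `P⁻¹` at `x` is the conjugate of the
  -- form of `P` at `y`; positivity thus transfers to the inverse.
  have hs : ((1 - (κ : ℂ) * z ^ 2) * (star x ⬝ᵥ y)) =
      star (star (1 - (κ : ℂ) * z ^ 2) * (star y ⬝ᵥ x)) := by
    rw [star_mul', star_star, ← Matrix.star_dotProduct]
  rw [hs, Complex.star_def, Complex.conj_re, hx]
  by_cases h : y = 0
  · simp [h]
  · exact (re_star_mul_faberDenom_form_pos h0 h1 hM hz h).le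

theorem norm_add_star_le_of_re_form_nonneg {H : Matrix ι ι ℂ}
    (hH : ∀ x : ι → ℂ, 0 ≤ (star x ⬝ᵥ (H *ᵥ x)).re) (k l : ι) :
    ‖H k l + star (H l k)‖ ≤ (H k k).re + (H l l).re := by
  obtain ⟨u, hu, hu2⟩ : ∃ u : ℂ, star u * u = 1 ∧
      star u * (H k l + star (H l k)) = -(‖H k l + star (H l k)‖ : ℂ) := by
    set t := H k l + star (H l k) with ht
    by_cases h : t = 0
    · exact ⟨1, by simp, by simp [h]⟩
    · have hn : (‖t‖ : ℂ) ≠ 0 := by simpa using h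
      have hc : star t * t = (‖t‖ : ℂ) ^ 2 := Complex.conj_mul' t
      have hr : star (‖t‖ : ℂ) = ‖t‖ := Complex.conj_ofReal _
      refine ⟨-(t / ‖t‖), ?_, ?_⟩
      · rw [star_neg, star_div₀, hr]
        field_simp
        rw [hc]
      · rw [star_neg, star_div₀, hr]
        field_simp
        rw [hc]
  -- The unimodular `u` rotates the off-diagonal contribution onto the negative real axis.
  have := hH (Pi.single k u + Pi.single l 1)
  rw [star_add, Pi.star_single, Pi.star_single, Matrix.mulVec_add, add_dotProduct, dotProduct_add,
    dotProduct_add] at this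
  simp only [Matrix.mulVec_single, single_dotProduct, Pi.smul_apply, Matrix.col_apply,
    MulOpposite.smul_eq_mul_unop, MulOpposite.unop_op, star_one, one_mul, mul_one] at this
  have e1 : star u * (H k k * u) = H k k := by
    rw [mul_left_comm, hu, mul_one]
  have e2 : (star u * H k l).re + (H l k * u).re = -‖H k l + star (H l k)‖ := by
    have h3 := congrArg Complex.re hu2
    rw [mul_add, Complex.add_re, ← star_mul', Complex.star_def, Complex.conj_re,
      mul_comm u] at h3
    simpa using h3
  rw [e1] at this
  simp only [Complex.add_re] at this
  linarith

/-! ### Analyticity and expansion of the generating function -/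

theorem differentiable_det {N : ℂ → Matrix ι ι ℂ} (h : ∀ i j, Differentiable ℂ fun z => N z i j) :
    Differentiable ℂ fun z => (N z).det := by
  simp only [Matrix.det_apply]
  refine Differentiable.fun_sum fun σ _ => Differentiable.const_smul ?_ _
  exact Differentiable.fun_finsetProd fun i _ => h _ _

theorem differentiable_faberDenom_entry {ι : Type*} [DecidableEq ι] (κ : ℝ)
    (M : Matrix ι ι ℂ) (i j : ι) :
    Differentiable ℂ fun z => faberDenom κ M z i j := by
  simp only [faberDenom, Matrix.sub_apply, Matrix.smul_apply, smul_eq_mul]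
  fun_prop

theorem differentiableOn_inv_faberDenom_entry
    (hu : ∀ z : ℂ, ‖z‖ < 1 → IsUnit (faberDenom κ M z).det) (i j : ι) :
    DifferentiableOn ℂ (fun z => (faberDenom κ M z)⁻¹ i j) (Metric.ball 0 1) := by
  have h1 := differentiable_det (differentiable_faberDenom_entry κ M)
  have h2 : Differentiable ℂ fun z => (faberDenom κ M z).adjugate i j := by
    simp only [Matrix.adjugate_apply]
    refine differentiable_det fun a b => ?_
    by_cases h : a = j
    · subst h; simp
    · simpa [Matrix.updateRow_ne h] using differentiable_faberDenom_entry κ M a b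
  simp only [Matrix.inv_def, Matrix.smul_apply, smul_eq_mul, Ring.inverse_eq_inv']
  exact (h1.differentiableOn.inv fun z hz => (hu z (by simpa using hz)).ne_zero).mul
    h2.differentiableOn

/-- The remainder in the expansion of the generating function of the Faber polynomials. -/
noncomputable def faberRemainder (κ : ℝ) (M : Matrix ι ι ℂ) (j : ℕ) (z : ℂ) : Matrix ι ι ℂ :=
  (faberMatrix κ M (j + 1) - ((κ : ℂ) * z) • faberMatrix κ M j) * (faberDenom κ M z)⁻¹

/-- The remainder plays the role of the tail `∑_i z^i F_{j+1+i}`. Once the common factor `P⁻¹` is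
removed, the identity is the three-term recurrence. -/
theorem faberRemainder_eq {z : ℂ} (hu : IsUnit (faberDenom κ M z).det) (j : ℕ) :
    faberRemainder κ M j z =
      faberMatrix κ M (j + 1) + z • faberRemainder κ M (j + 1) z := by
  have hP := Matrix.mul_nonsing_inv _ hu
  have : faberMatrix κ M (j + 1) =
      (faberMatrix κ M (j + 1) * faberDenom κ M z) * (faberDenom κ M z)⁻¹ := by
    rw [Matrix.mul_assoc, hP, Matrix.mul_one]
  have hcomm : ∀ i, Commute M (faberMatrix κ M i) := by
    intro i
    induction i using faberMatrix.induct with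
    | case1 => exact Commute.ofNat_right M 2
    | case2 => exact Commute.refl M
    | case3 i h1 h2 => exact ((Commute.refl M).mul_right h1).sub_right (h2.smul_right _)
  conv_rhs => rw [this]
  rw [faberRemainder, faberRemainder, ← Matrix.smul_mul, ← Matrix.add_mul]
  congr 1
  rw [faberMatrix, faberDenom, Matrix.mul_sub, Matrix.mul_smul, Matrix.mul_smul, Matrix.mul_one,
    ← (hcomm (j + 1)).eq]
  module

theorem generating_eq {z : ℂ} (hu : IsUnit (faberDenom κ M z).det) :
    (1 - (κ : ℂ) * z ^ 2) • (faberDenom κ M z)⁻¹ = 1 + z • faberRemainder κ M 0 z := by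
  have hP := Matrix.mul_nonsing_inv _ hu
  rw [← hP, faberRemainder, ← Matrix.smul_mul, ← Matrix.add_mul]
  nth_rewrite 1 [← Matrix.one_mul (faberDenom κ M z)⁻¹]
  rw [← Matrix.smul_mul]
  congr 1
  simp only [faberMatrix, faberDenom]
  have : (2 : Matrix ι ι ℂ) = (2 : ℂ) • 1 := by rw [ofNat_smul_eq_nsmul]; simp
  rw [this]
  module

theorem generating_expansion {z : ℂ} (hu : IsUnit (faberDenom κ M z).det) (j : ℕ) :
    (1 - (κ : ℂ) * z ^ 2) • (faberDenom κ M z)⁻¹ =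
      ∑ i ∈ Finset.range (j + 1), z ^ i • (if i = 0 then 1 else faberMatrix κ M i) +
        z ^ (j + 1) • faberRemainder κ M j z := by
  induction j with
  | zero => simp [generating_eq hu]
  | succ j ih =>
    rw [ih, Finset.sum_range_succ _ (j + 1), faberRemainder_eq hu j, if_neg j.succ_ne_zero,
      smul_add, smul_smul, ← pow_succ, ← add_assoc]

/-- Off-diagonal entries of the Faber polynomials of a matrix are bounded by `2`. -/
theorem norm_faberMatrix_apply_le (h0 : 0 ≤ κ) (h1 : κ < 1)
    (hM : ∀ y : ι → ℂ, ∃ w : ℂ, ‖w‖ ≤ 1 ∧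
      star y ⬝ᵥ (M *ᵥ y) = (star y ⬝ᵥ y) * (w + κ * star w)) (j : ℕ) (k l : ι) :
    ‖faberMatrix κ M (j + 1) k l‖ ≤ 2 := by
  have hu : ∀ z : ℂ, ‖z‖ < 1 → IsUnit (faberDenom κ M z).det := fun z hz =>
    isUnit_det_faberDenom h0 h1 hM hz
  have hinv := differentiableOn_inv_faberDenom_entry hu
  set H : ℂ → Matrix ι ι ℂ := fun z => (1 - (κ : ℂ) * z ^ 2) • (faberDenom κ M z)⁻¹ with hH
  have hHd : ∀ i j, DifferentiableOn ℂ (fun z => H z i j) (Metric.ball 0 1) := by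
    intro i j
    simp only [hH, Matrix.smul_apply, smul_eq_mul]
    exact DifferentiableOn.mul (by fun_prop) (hinv i j)
  have hRd : DifferentiableOn ℂ (fun z => faberRemainder κ M j z k l) (Metric.ball 0 1) := by
    simp only [faberRemainder, Matrix.mul_apply, Matrix.sub_apply, Matrix.smul_apply, smul_eq_mul]
    refine DifferentiableOn.fun_sum fun i _ => DifferentiableOn.mul (by fun_prop) (hinv i l)
  have hP0 : faberDenom κ M 0 = 1 := by simp [faberDenom]
  have hH0 : ∀ i, H 0 i i = 1 := by intro i; simp [hH, hP0]
  have hR0 : faberRemainder κ M j 0 k l = faberMatrix κ M (j + 1) k l := by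
    simp [faberRemainder, hP0]
  rw [← hR0]
  refine norm_coeff_le_two_of_re_bound (f := fun z => H z k l)
    (d := fun i => (if i = 0 then (1 : Matrix ι ι ℂ) else faberMatrix κ M i) k l) j.succ_pos
    (hHd l k) (hHd k k) (hHd l l) hRd (hH0 k) (hH0 l) ?_ ?_
  · intro z hz
    have := congrFun (congrFun (generating_expansion (hu z (by simpa using hz)) j) k) l
    simp only [hH]
    rw [this, Matrix.add_apply, Matrix.sum_apply]
    simp only [Matrix.smul_apply, smul_eq_mul, mul_comm (z ^ _)]
  · intro z hz
    exact norm_add_star_le_of_re_form_nonneg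
      (re_form_generating_nonneg h0 h1 hM (by simpa using hz)) k l

end

/-! ### From Faber polynomials to powers and the exponential -/

section
variable {ι : Type*} [Fintype ι] [DecidableEq ι] {κ : ℝ} {M : Matrix ι ι ℂ}

/-- The scalars `φ_j = τ^j + κ^j τ^{-j}` satisfy the recurrence of the `F_j` with `M` replaced by `τ
+ κ/τ`, including `φ_0 = 2`. Because `κ ≥ 0`, `M F_{j+1} = F_{j+2} + κ F_j` has nonnegative
coefficients and the majorant propagates. -/
theorem norm_pow_mul_faberMatrix_apply_le (hκ : 0 ≤ κ) {τ C : ℝ} (hτ : 0 < τ) {k l : ι}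
    (hbase : ∀ j, ‖faberMatrix κ M j k l‖ ≤ C * (τ ^ j + κ ^ j * (τ ^ j)⁻¹)) (i j : ℕ) :
    ‖(M ^ i * faberMatrix κ M j) k l‖ ≤
      C * (τ + κ / τ) ^ i * (τ ^ j + κ ^ j * (τ ^ j)⁻¹) := by
  induction i generalizing j with
  | zero => simpa using hbase j
  | succ i ih =>
    rcases j with _ | j
    · have h2 : M ^ (i + 1) * faberMatrix κ M 0 = (2 : ℂ) • (M ^ i * faberMatrix κ M 1) := by
        rw [faberMatrix, faberMatrix, pow_succ, mul_two, two_smul]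
      rw [h2, Matrix.smul_apply, norm_smul]
      have := ih 1
      simp only [pow_one, pow_zero, Complex.norm_ofNat] at this ⊢
      calc 2 * _ ≤ 2 * _ := mul_le_mul_of_nonneg_left this zero_le_two
        _ = _ := by rw [pow_succ]; field_simp; norm_num; ring
    · have h2 : M ^ (i + 1) * faberMatrix κ M (j + 1) =
          M ^ i * faberMatrix κ M (j + 2) + (κ : ℂ) • (M ^ i * faberMatrix κ M j) := by
        rw [faberMatrix, Matrix.mul_sub, Matrix.mul_smul, sub_add_cancel, pow_succ, Matrix.mul_assoc]
      rw [h2, Matrix.add_apply, Matrix.smul_apply]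
      refine (norm_add_le _ _).trans ?_
      rw [norm_smul, Complex.norm_real, Real.norm_eq_abs, abs_of_nonneg hκ]
      refine (add_le_add (ih (j + 2)) (mul_le_mul_of_nonneg_left (ih j) hκ)).trans_eq ?_
      rw [pow_succ (τ + κ / τ) i]
      field_simp
      ring

theorem norm_pow_apply_le (hκ : 0 ≤ κ) {τ : ℝ} (hτ : 1 ≤ τ) {k l : ι} (hkl : k ≠ l) {m : ℕ}
    (hz : ∀ j < m, faberMatrix κ M j k l = 0)
    (hle : ∀ j, ‖faberMatrix κ M (j + 1) k l‖ ≤ 2) (i : ℕ) :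
    ‖(M ^ i) k l‖ ≤ 2 * (τ ^ m)⁻¹ * (τ + κ / τ) ^ i := by
  have hτ0 : 0 < τ := zero_lt_one.trans_le hτ
  have hbase : ∀ j, ‖faberMatrix κ M j k l‖ ≤
      2 * (τ ^ m)⁻¹ * (τ ^ j + κ ^ j * (τ ^ j)⁻¹) := by
    intro j
    by_cases hj : j < m
    · rw [hz j hj, norm_zero]; positivity
    · have h2 : ‖faberMatrix κ M j k l‖ ≤ 2 := by
        rcases j with _ | j
        · have : (2 : Matrix ι ι ℂ) k l = 0 := by
            rw [← Nat.cast_ofNat, ← Matrix.diagonal_natCast, Matrix.diagonal_apply_ne _ hkl]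
          simp [faberMatrix, this]
        · exact hle j
      -- For `j ≥ m` the uniform bound 2 may be inflated by `τ^{j-m} ≥ 1`, which gives the form the
      -- majorant requires.
      have h3 : 1 ≤ (τ ^ m)⁻¹ * τ ^ j := by
        rw [inv_mul_eq_div, one_le_div (by positivity)]
        exact pow_le_pow_right₀ hτ (not_lt.1 hj)
      have h4 : 0 ≤ (τ ^ m)⁻¹ * (κ ^ j * (τ ^ j)⁻¹) := by positivity
      nlinarith
  have := norm_pow_mul_faberMatrix_apply_le hκ hτ0 hbase i 0
  have h2 : M ^ i * faberMatrix κ M 0 = (2 : ℂ) • M ^ i := by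
    rw [faberMatrix, mul_two, two_smul]
  rw [h2, Matrix.smul_apply, norm_smul] at this
  norm_num at this
  linarith

theorem norm_exp_smul_apply_le {s C t : ℝ} (hs : 0 ≤ s) {k l : ι}
    (h : ∀ i : ℕ, ‖(M ^ i) k l‖ ≤ C * t ^ i) :
    ‖NormedSpace.exp ((s : ℂ) • M) k l‖ ≤ C * Real.exp (s * t) := by
  let _ : NormedRing (Matrix ι ι ℂ) := Matrix.linftyOpNormedRing
  let _ : NormedAlgebra ℂ (Matrix ι ι ℂ) := Matrix.linftyOpNormedAlgebra
  have h1 : HasSum (fun i : ℕ => ((i.factorial : ℂ)⁻¹ • ((s : ℂ) • M) ^ i) k l)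
      (NormedSpace.exp ((s : ℂ) • M) k l) := by
    have := NormedSpace.exp_series_hasSum_exp' (𝕂 := ℂ) ((s : ℂ) • M)
    exact Pi.hasSum.1 (Pi.hasSum.1 this k) l
  have h2 : HasSum (fun i : ℕ => C * ((i.factorial : ℝ)⁻¹ * (s * t) ^ i))
      (C * Real.exp (s * t)) := by
    have := NormedSpace.exp_series_hasSum_exp' (𝕂 := ℝ) (s * t)
    rw [← Real.exp_eq_exp_ℝ] at this
    exact this.mul_left C
  refine h1.norm_le_of_bounded h2 fun i => ?_
  rw [smul_pow, Matrix.smul_apply, Matrix.smul_apply, norm_smul, norm_smul, norm_inv, norm_pow,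
    Complex.norm_natCast, Complex.norm_real, Real.norm_eq_abs, abs_of_nonneg hs, mul_pow]
  calc _ ≤ (i.factorial : ℝ)⁻¹ * (s ^ i * (C * t ^ i)) := by gcongr; exact h i
    _ = _ := by ring

end

/-! ### Bandedness -/

section
variable {n : ℕ} {β γ β' γ' : ℕ} {A B : Matrix (Fin n) (Fin n) ℂ}

theorem IsBandedMatrix.mono (h : IsBandedMatrix β γ A) (hβ : β ≤ β') (hγ : γ ≤ γ') :
    IsBandedMatrix β' γ' A := fun k l hkl => h k l (by omega)

theorem IsBandedMatrix.smul (h : IsBandedMatrix β γ A) (c : ℂ) : IsBandedMatrix β γ (c • A) :=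
  fun k l hkl => by rw [Matrix.smul_apply, h k l hkl, smul_zero]

theorem IsBandedMatrix.sub (hA : IsBandedMatrix β γ A) (hB : IsBandedMatrix β γ B) :
    IsBandedMatrix β γ (A - B) :=
  fun k l hkl => by rw [Matrix.sub_apply, hA k l hkl, hB k l hkl, sub_zero]

theorem isBandedMatrix_one : IsBandedMatrix β γ (1 : Matrix (Fin n) (Fin n) ℂ) :=
  fun k l hkl => Matrix.one_apply_ne (by rintro rfl; omega)

theorem IsBandedMatrix.mul (hA : IsBandedMatrix β γ A) (hB : IsBandedMatrix β' γ' B) :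
    IsBandedMatrix (β + β') (γ + γ') (A * B) := by
  intro k l hkl
  rw [Matrix.mul_apply]
  refine Finset.sum_eq_zero fun i _ => ?_
  by_cases h : (β : ℤ) < (i : ℤ) - k ∨ (γ : ℤ) < (k : ℤ) - i
  · rw [hA k i h, zero_mul]
  · rw [hB i l (by push_cast at hkl; omega), mul_zero]

theorem IsBandedMatrix.faberMatrix {κ : ℝ} (hA : IsBandedMatrix β γ A) (j : ℕ) :
    IsBandedMatrix (j * β) (j * γ) (faberMatrix κ A j) := by
  induction j using faberMatrix.induct with
  | case1 =>
    have : (2 : Matrix (Fin n) (Fin n) ℂ) = (2 : ℂ) • 1 := by rw [ofNat_smul_eq_nsmul]; simp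
    rw [_root_.faberMatrix, this]
    exact isBandedMatrix_one.smul 2
  | case2 => simpa [_root_.faberMatrix] using hA
  | case3 j h1 h2 =>
    exact ((hA.mul h1).mono (by grind) (by grind)).sub
      ((h2.smul _).mono (by gcongr; omega) (by gcongr; omega))

theorem IsBandedMatrix.faberMatrix_apply_eq_zero {κ : ℝ} (hA : IsBandedMatrix β γ A) (hβ : 0 < β)
    (hγ : 0 < γ) {k l : Fin n} {j : ℕ} (hj : j < bandIndex β γ k l) :
    _root_.faberMatrix κ A j k l = 0 := by
  refine hA.faberMatrix j k l ?_
  rw [bandIndex] at hj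
  split_ifs at hj with h
  · rw [Nat.lt_ceil, lt_div_iff₀ (by exact_mod_cast hβ)] at hj
    left
    rify
    exact hj
  · rw [Nat.lt_ceil, lt_div_iff₀ (by exact_mod_cast hγ)] at hj
    right
    rify
    exact hj

theorem bandIndex_self (k : Fin n) : bandIndex β γ k k = 0 := by simp [bandIndex]

/-! ### Geometry of the ellipse and normalization -/

/-- A compact set whose frontier is an ellipse lies in the region enclosed by it. -/
theorem subset_filled_ellipse {a b : ℝ} {c : ℂ} {E : Set ℂ} (hE : IsCompact E)
    (hf : frontier E = horizontalEllipse a b c) {z : ℂ} (hz : z ∈ E) :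
    ((z.re - c.re) / a) ^ 2 + ((z.im - c.im) / b) ^ 2 ≤ 1 := by
  by_contra! hlt
  -- The outward ray from a point outside the ellipse never meets the frontier, so by connectedness
  -- it stays in `E`, contradicting boundedness.
  set g : ℝ → ℂ := fun t => c + (t : ℂ) * (z - c) with hg
  have hcont : Continuous g := by fun_prop
  have hconn : IsPreconnected (g '' Set.Ici 1) :=
    isPreconnected_Ici.image _ hcont.continuousOn
  have hdisj : Disjoint (g '' Set.Ici 1) (frontier E) := by
    rw [Set.disjoint_left]
    rintro _ ⟨t, ht, rfl⟩ h
    rw [hf] at h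
    simp only [horizontalEllipse, Set.mem_ofPred_eq, hg, Complex.add_re, Complex.add_im,
      Complex.re_ofReal_mul, Complex.im_ofReal_mul, Complex.sub_re, Complex.sub_im,
      add_sub_cancel_left, mul_div_assoc, mul_pow, ← mul_add] at h
    have ht1 : 1 ≤ t ^ 2 := one_le_pow₀ ht
    nlinarith
  have hsub : g '' Set.Ici 1 ⊆ E := by
    have hcl : IsClosed E := hE.isClosed
    refine (hconn.subset_left_of_subset_union isOpen_interior hcl.isOpen_compl
      (disjoint_compl_right.mono_left interior_subset) ?_ ?_).trans interior_subset
    · intro x hx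
      by_cases hxE : x ∈ E
      · left
        by_contra hxi
        refine Set.disjoint_left.1 hdisj hx ?_
        rw [hcl.frontier_eq]
        exact ⟨hxE, hxi⟩
      · exact Or.inr hxE
    · have hzg : z ∈ g '' Set.Ici 1 := ⟨1, Set.self_mem_Ici, by simp [hg]⟩
      refine ⟨z, hzg, ?_⟩
      by_contra hxi
      refine Set.disjoint_left.1 hdisj hzg ?_
      rw [hcl.frontier_eq]
      exact ⟨hz, hxi⟩
  have hzc : 0 < ‖z - c‖ := by
    rw [norm_pos_iff, sub_ne_zero]
    rintro rfl
    norm_num at hlt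
  obtain ⟨r, hr⟩ := hE.isBounded.subset_closedBall c
  have hm := hr (hsub ⟨max 1 ((r + 1) / ‖z - c‖), Set.mem_Ici.2 (le_max_left _ _), rfl⟩)
  rw [Metric.mem_closedBall, dist_eq_norm] at hm
  simp only [hg, add_sub_cancel_left, norm_mul, Complex.norm_real, Real.norm_eq_abs] at hm
  have h1 : (r + 1) / ‖z - c‖ ≤ |max 1 ((r + 1) / ‖z - c‖)| :=
    (le_max_right _ _).trans (le_abs_self _)
  rw [div_le_iff₀ hzc] at h1
  linarith

theorem form_mem_of_fieldOfValues_subset {E : Set ℂ} (hA : fieldOfValues A ⊆ E) {y : Fin n → ℂ}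
    (hy : y ≠ 0) : ∃ z ∈ E, star y ⬝ᵥ (A *ᵥ y) = (star y ⬝ᵥ y) * z := by
  set v : EuclideanSpace ℂ (Fin n) := WithLp.toLp 2 y with hv
  have hvn : ‖v‖ ≠ 0 := by simpa [hv] using hy
  have hvc : (‖v‖ : ℂ) ≠ 0 := by exact_mod_cast hvn
  have hyy : star y ⬝ᵥ y = (‖v‖ : ℂ) ^ 2 := by
    have h := inner_self_eq_norm_sq_to_K (𝕜 := ℂ) v
    rw [EuclideanSpace.inner_eq_star_dotProduct, dotProduct_comm] at h
    exact h
  refine ⟨_, hA ⟨(‖v‖ : ℂ)⁻¹ • v, ?_, rfl⟩, ?_⟩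
  · rw [norm_smul, norm_inv, Complex.norm_real, norm_norm, inv_mul_cancel₀ hvn]
  · have hs : star (‖v‖ : ℂ)⁻¹ = (‖v‖ : ℂ)⁻¹ := by
      rw [star_inv₀]; exact congrArg _ (Complex.conj_ofReal _)
    rw [WithLp.ofLp_smul, Matrix.mulVec_smul, star_smul, smul_dotProduct, dotProduct_smul, hs, hyy,
      smul_eq_mul, smul_eq_mul]
    field_simp
    rfl

/-- The normalization of a matrix whose field of values lies in an ellipse with semi-axes
`a`, `b`: the ellipse becomes the image of the unit disk under `w ↦ w + κ w̄`. -/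
theorem exists_form_normalized {a b : ℝ} {c : ℂ} (hb : 0 < b) (hab : b ≤ a) {E : Set ℂ}
    (hE : IsCompact E) (hf : frontier E = horizontalEllipse a b c) (hA : fieldOfValues A ⊆ E)
    (y : Fin n → ℂ) : ∃ w : ℂ, ‖w‖ ≤ 1 ∧
      star y ⬝ᵥ (((((a + b) / 2 : ℝ) : ℂ)⁻¹ • (A - c • 1)) *ᵥ y) =
        (star y ⬝ᵥ y) * (w + ((a - b) / (a + b) : ℝ) * star w) := by
  by_cases hy : y = 0
  · exact ⟨0, by simp, by simp [hy]⟩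
  have ha : 0 < a := hb.trans_le hab
  obtain ⟨z, hz, h⟩ := form_mem_of_fieldOfValues_subset hA hy
  have hz1 := subset_filled_ellipse hE hf hz
  -- Since `s(1 + κ) = a` and `s(1 - κ) = b`, one has `s(w + κ w̄) = a Re w + i b Im w`.
  refine ⟨⟨(z.re - c.re) / a, (z.im - c.im) / b⟩, ?_, ?_⟩
  · rw [← sq_le_one_iff₀ (norm_nonneg _), ← Complex.normSq_eq_norm_sq, Complex.normSq_apply]
    simpa [pow_two] using hz1
  · rw [Matrix.smul_mulVec, Matrix.sub_mulVec, Matrix.smul_mulVec, Matrix.one_mulVec,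
      dotProduct_smul, dotProduct_sub, dotProduct_smul, h, smul_eq_mul, smul_eq_mul,
      mul_comm c, ← mul_sub, mul_left_comm]
    congr 1
    rw [← Complex.ofReal_inv]
    apply Complex.ext
    · rw [Complex.re_ofReal_mul, Complex.add_re, Complex.re_ofReal_mul]
      simp only [Complex.sub_re, Complex.star_def, Complex.conj_re]
      field_simp
      ring
    · rw [Complex.im_ofReal_mul, Complex.add_im, Complex.im_ofReal_mul]
      simp only [Complex.sub_im, Complex.star_def, Complex.conj_im]
      field_simp
      ring

end

/-! ### The explicit bound -/

section
variable {a b : ℝ}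

/-- Factoring `a² - b² = (D - x)(D + x)` collapses `q` to `D / x`. -/
theorem natCast_mul_ellipseQ {x : ℝ} (hx : 0 < x) (hab : 0 ≤ a ^ 2 - b ^ 2) :
    x * ellipseQ a b x = √(x ^ 2 + a ^ 2 - b ^ 2) := by
  set D := √(x ^ 2 + a ^ 2 - b ^ 2) with hD
  have hD0 : 0 ≤ D := Real.sqrt_nonneg _
  have hD2 : D ^ 2 = x ^ 2 + a ^ 2 - b ^ 2 := Real.sq_sqrt (by nlinarith)
  have h1 : 0 < x + D := by linarith
  rw [ellipseQ, ← hD, show a ^ 2 - b ^ 2 = (D - x) * (D + x) by linarith]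
  rw [show x ^ 2 + x * D = x * (x + D) by ring]
  field_simp
  ring

theorem ellipse_ratio_eq {x : ℝ} (hx : 0 < x) :
    (a + b) / x * (1 + √(1 + (a ^ 2 - b ^ 2) / x ^ 2))⁻¹ =
      (a + b) / (x + √(x ^ 2 + a ^ 2 - b ^ 2)) := by
  have : √(x ^ 2 + a ^ 2 - b ^ 2) = x * √(1 + (a ^ 2 - b ^ 2) / x ^ 2) := by
    conv_rhs => rw [← Real.sqrt_sq hx.le]
    rw [Real.sqrt_sq hx.le, ← Real.sqrt_sq hx.le, ← Real.sqrt_mul (sq_nonneg _), Real.sqrt_sq hx.le]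
    congr 1
    field_simp
    ring
  rw [this]
  field_simp

theorem expDecayBound_eq {c₁ : ℝ} {ξ : ℕ} (hξ : 0 < ξ) (hab : 0 ≤ a ^ 2 - b ^ 2) :
    expDecayBound a b c₁ ξ =
      2 * Real.exp c₁ * (((ξ : ℝ) + √((ξ : ℝ) ^ 2 + a ^ 2 - b ^ 2)) /
        ((ξ : ℝ) + √((ξ : ℝ) ^ 2 + a ^ 2 - b ^ 2) - (a + b))) *
      (((a + b) / ((ξ : ℝ) + √((ξ : ℝ) ^ 2 + a ^ 2 - b ^ 2))) ^ ξ *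
        Real.exp √((ξ : ℝ) ^ 2 + a ^ 2 - b ^ 2)) := by
  have hx : (0 : ℝ) < ξ := by exact_mod_cast hξ
  rw [expDecayBound, ← natCast_mul_ellipseQ hx hab, Real.exp_nat_mul, ← mul_pow,
    natCast_mul_ellipseQ hx hab, ← ellipse_ratio_eq hx]
  congr 2
  ring

theorem exp_add_smul_one_apply {ι : Type*} [Fintype ι] [DecidableEq ι] (c : ℂ)
    (A : Matrix ι ι ℂ) (k l : ι) :
    NormedSpace.exp (c • 1 + A) k l = Complex.exp c * NormedSpace.exp A k l := by
  have hc : NormedSpace.exp (c • (1 : Matrix ι ι ℂ)) = Complex.exp c • 1 := by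
    have h := Matrix.exp_diagonal (𝔸 := ℂ) (fun _ : ι => c)
    rw [← Matrix.smul_one_eq_diagonal] at h
    rw [h, Matrix.smul_one_eq_diagonal, Complex.exp_eq_exp_ℂ]
    congr 1
    ext i
    exact Pi.coe_exp (𝔸 := fun _ : ι => ℂ) _ i
  rw [Matrix.exp_add_of_commute _ _ ((Commute.one_left A).smul_left c), hc, Matrix.smul_mul,
    Matrix.one_mul, Matrix.smul_apply, smul_eq_mul]

theorem norm_exp_apply_le_expDecayBound {c : ℂ} (hb : 0 < b) (hab : b ≤ a) {n β γ : ℕ}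
    (hβ : 0 < β) (hγ : 0 < γ) {A : Matrix (Fin n) (Fin n) ℂ} (hA : IsBandedMatrix β γ A)
    {E : Set ℂ} (hE : IsCompact E) (hf : frontier E = horizontalEllipse a b c)
    (hW : fieldOfValues A ⊆ E) {k l : Fin n} (hξ : b < (bandIndex β γ k l : ℝ)) :
    ‖(NormedSpace.exp A) k l‖ ≤ expDecayBound a b c.re (bandIndex β γ k l) := by
  have hkl : k ≠ l := by
    rintro rfl
    rw [bandIndex_self, Nat.cast_zero] at hξ
    linarith
  set m := bandIndex β γ k l with hm
  have ha : 0 < a := hb.trans_le hab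
  have hm0 : (0 : ℝ) < m := hb.trans hξ
  have hd : 0 ≤ a ^ 2 - b ^ 2 := by nlinarith
  set D := √((m : ℝ) ^ 2 + a ^ 2 - b ^ 2) with hD
  have hD2 : D ^ 2 = (m : ℝ) ^ 2 + a ^ 2 - b ^ 2 := Real.sq_sqrt (by nlinarith)
  have hDa : a < D := Real.lt_sqrt_of_sq_lt (by nlinarith)
  have hs : 0 < (a + b) / 2 := by linarith
  set s : ℝ := (a + b) / 2 with hsdef
  set κ : ℝ := (a - b) / (a + b) with hκdef
  have hκ0 : 0 ≤ κ := div_nonneg (by linarith) (by linarith)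
  have hκ1 : κ < 1 := by rw [hκdef, div_lt_one (by linarith)]; linarith
  set M : Matrix (Fin n) (Fin n) ℂ := (s : ℂ)⁻¹ • (A - c • 1) with hM
  have hMb : IsBandedMatrix β γ M := (hA.sub (isBandedMatrix_one.smul c)).smul _
  -- This minimizes `τ^{-m} e^{s(τ + κ/τ)}`: the critical equation `s(τ - κ/τ) = m` has it as
  -- positive root. The condition `m > b` gives `D > a`, hence `τ ≥ 1`.
  set τ : ℝ := (m + D) / (a + b) with hτdef
  have hτ : 1 ≤ τ := by rw [hτdef, one_le_div (by linarith)]; linarith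
  have hpow := norm_pow_apply_le hκ0 hτ hkl
    (fun j hj => hMb.faberMatrix_apply_eq_zero (κ := κ) hβ hγ hj)
    (fun j => norm_faberMatrix_apply_le hκ0 hκ1 (exists_form_normalized hb hab hE hf hW) j k l)
  have hexp := norm_exp_smul_apply_le hs.le hpow
  have hAeq : A = c • 1 + (s : ℂ) • M := by
    rw [hM, smul_smul, mul_inv_cancel₀ (by exact_mod_cast hs.ne'), one_smul, add_sub_cancel]
  have hst : s * (τ + κ / τ) = D := by
    have h1 : 0 < (m : ℝ) + D := by linarith
    have h2 : 0 < a + b := by linarith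
    rw [hsdef, hκdef, hτdef]
    field_simp
    nlinarith
  have hfac : 1 ≤ ((m : ℝ) + D) / (m + D - (a + b)) := by
    rw [one_le_div (by linarith)]; linarith
  rw [expDecayBound_eq (by exact_mod_cast hm0) hd, ← hD, hAeq, exp_add_smul_one_apply, norm_mul,
    Complex.norm_exp]
  rw [hst] at hexp
  have hinv : (a + b) / ((m : ℝ) + D) = τ⁻¹ := by rw [hτdef, inv_div]
  rw [hinv, inv_pow]
  calc Real.exp c.re * _ ≤ Real.exp c.re * (2 * (τ ^ m)⁻¹ * Real.exp D) := by gcongr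
    _ = 2 * Real.exp c.re * 1 * ((τ ^ m)⁻¹ * Real.exp D) := by ring
    _ ≤ _ := by gcongr

/-! ### Asymptotics of the bound -/

open Filter Topology in
theorem tendsto_sqrt_ellipse_sub (hd : 0 ≤ a ^ 2 - b ^ 2) :
    Tendsto (fun ξ : ℕ => √((ξ : ℝ) ^ 2 + a ^ 2 - b ^ 2) - ξ) atTop (𝓝 0) := by
  have hlim : Tendsto (fun ξ : ℕ => (a ^ 2 - b ^ 2) / (ξ : ℝ)) atTop (𝓝 0) :=
    tendsto_const_div_atTop_nhds_zero_nat _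
  refine squeeze_zero' ?_ ?_ hlim
  · refine Eventually.of_forall fun ξ => sub_nonneg.2 (Real.le_sqrt_of_sq_le (by linarith))
  · filter_upwards [eventually_gt_atTop 0] with ξ hξ
    have hx : (0 : ℝ) < ξ := by exact_mod_cast hξ
    rw [sub_le_iff_le_add]
    refine Real.sqrt_le_left (by positivity) |>.2 ?_
    have : (a ^ 2 - b ^ 2) / (ξ : ℝ) * ξ = a ^ 2 - b ^ 2 := div_mul_cancel₀ _ hx.ne'
    nlinarith [sq_nonneg ((a ^ 2 - b ^ 2) / (ξ : ℝ))]

open Filter Topology in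
theorem expDecayBound_isEquivalent (c₁ : ℝ) (hb : 0 < b) (hab : b ≤ a) :
    Asymptotics.IsEquivalent atTop (expDecayBound a b c₁)
      (fun ξ : ℕ => 2 * Real.exp c₁ * (Real.exp 1 * ((a + b) / (2 * (ξ : ℝ)))) ^ ξ) := by
  have ha : 0 < a := hb.trans_le hab
  have hd : 0 ≤ a ^ 2 - b ^ 2 := by nlinarith
  set D : ℕ → ℝ := fun ξ => √((ξ : ℝ) ^ 2 + a ^ 2 - b ^ 2) with hD
  have hDlim := tendsto_sqrt_ellipse_sub hd
  have hDge : ∀ ξ : ℕ, (ξ : ℝ) ≤ D ξ := fun ξ => Real.le_sqrt_of_sq_le (by linarith)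
  have hxlim : Tendsto (fun ξ : ℕ => (ξ : ℝ)) atTop atTop := tendsto_natCast_atTop_atTop
  have hsum : Tendsto (fun ξ : ℕ => (ξ : ℝ) + D ξ) atTop atTop :=
    tendsto_atTop_mono (fun ξ => le_add_of_nonneg_right (Real.sqrt_nonneg _)) hxlim
  have hX : Tendsto (fun ξ : ℕ => ((ξ : ℝ) + D ξ) / (ξ + D ξ - (a + b))) atTop (𝓝 1) := by
    have h1 : Tendsto (fun ξ : ℕ => 1 - (a + b) / ((ξ : ℝ) + D ξ)) atTop (𝓝 (1 - 0)) :=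
      tendsto_const_nhds.sub (hsum.const_div_atTop _)
    have h2 := h1.inv₀ (by norm_num)
    rw [sub_zero, inv_one] at h2
    refine h2.congr' ?_
    filter_upwards [hsum.eventually_gt_atTop (a + b)] with ξ hξ
    have h3 : (ξ : ℝ) + D ξ ≠ 0 := by linarith
    have h4 : (ξ : ℝ) + D ξ - (a + b) ≠ 0 := by linarith
    rw [← inv_div]
    field_simp
  have hpow : Tendsto (fun ξ : ℕ => (2 * (ξ : ℝ) / (ξ + D ξ)) ^ ξ) atTop (𝓝 1) := by
    have hlow : Tendsto (fun ξ : ℕ => 1 - (D ξ - ξ)) atTop (𝓝 1) := by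
      simpa using (tendsto_const_nhds (x := (1 : ℝ))).sub hDlim
    refine tendsto_of_tendsto_of_tendsto_of_le_of_le' hlow tendsto_const_nhds ?_ ?_
    · filter_upwards [eventually_gt_atTop 0] with ξ hξ
      have hx : (0 : ℝ) < ξ := by exact_mod_cast hξ
      have h1 := hDge ξ
      have hsp : 0 < (ξ : ℝ) + D ξ := by linarith
      have h2 : 2 * (ξ : ℝ) / (ξ + D ξ) = 1 + -((D ξ - ξ) / (ξ + D ξ)) := by
        field_simp; ring
      have h3 : (D ξ - ξ) / (ξ + D ξ) ≤ 1 := by rw [div_le_one hsp]; linarith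
      -- Bernoulli's inequality suffices because `ξ (D - ξ)/(ξ + D) ≤ D - ξ`, which tends to 0.
      have h4 := one_add_mul_le_pow (a := -((D ξ - ξ) / (ξ + D ξ))) (by linarith) ξ
      rw [h2]
      refine le_trans ?_ h4
      have h5 : (ξ : ℝ) * ((D ξ - ξ) / (ξ + D ξ)) ≤ D ξ - ξ := by
        rw [mul_div_assoc', div_le_iff₀ hsp]
        nlinarith
      linarith
    · refine Eventually.of_forall fun ξ => ?_
      have h1 := hDge ξ
      have hx : (0 : ℝ) ≤ ξ := Nat.cast_nonneg _
      exact pow_le_one₀ (by positivity) (div_le_one_of_le₀ (by linarith) (by positivity))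
  have hexp : Tendsto (fun ξ : ℕ => Real.exp (D ξ - ξ)) atTop (𝓝 1) := by
    have h := (Real.continuous_exp.tendsto 0).comp hDlim
    rwa [Real.exp_zero] at h
  refine Asymptotics.isEquivalent_iff_exists_eq_mul.2
    ⟨fun ξ => ((ξ : ℝ) + D ξ) / (ξ + D ξ - (a + b)) * (2 * (ξ : ℝ) / (ξ + D ξ)) ^ ξ *
      Real.exp (D ξ - ξ), by simpa using (hX.mul hpow).mul hexp, ?_⟩
  filter_upwards [eventually_gt_atTop 0] with ξ hξ
  have hx : (0 : ℝ) < ξ := by exact_mod_cast hξ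
  have h1 := hDge ξ
  have hsp : (ξ : ℝ) + D ξ ≠ 0 := by linarith
  rw [Pi.mul_apply, expDecayBound_eq hξ hd]
  have e1 : Real.exp (D ξ) = Real.exp (D ξ - ξ) * Real.exp 1 ^ ξ := by
    rw [← Real.exp_nat_mul, ← Real.exp_add]; ring_nf
  have e2 : ((a + b) / ((ξ : ℝ) + D ξ)) ^ ξ =
      (2 * (ξ : ℝ) / (ξ + D ξ)) ^ ξ * ((a + b) / (2 * (ξ : ℝ))) ^ ξ := by
    rw [← mul_pow]; congr 1; field_simp
  change 2 * Real.exp c₁ * (((ξ : ℝ) + D ξ) / (ξ + D ξ - (a + b))) *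
    (((a + b) / ((ξ : ℝ) + D ξ)) ^ ξ * Real.exp (D ξ)) = _
  rw [e1, e2, mul_pow]
  ring

open Filter Topology in
-- The base is eventually below `r/2` in absolute value, and `(r/2)^ξ = o(r^ξ)`.
theorem pow_const_div_natCast_isLittleO (K r : ℝ) (hr : 0 < r) :
    (fun ξ : ℕ => (K / (ξ : ℝ)) ^ ξ) =o[atTop] (fun ξ : ℕ => r ^ ξ) := by
  have hlim : Tendsto (fun ξ : ℕ => K / (ξ : ℝ)) atTop (𝓝 0) :=
    tendsto_const_div_atTop_nhds_zero_nat _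
  have hsmall : ∀ᶠ ξ : ℕ in atTop, |K / (ξ : ℝ)| < r / 2 := by
    have h := hlim.abs
    rw [abs_zero] at h
    exact h.eventually_lt_const (by positivity)
  have hO : (fun ξ : ℕ => (K / (ξ : ℝ)) ^ ξ) =O[atTop] (fun ξ : ℕ => (r / 2) ^ ξ) := by
    refine Asymptotics.IsBigO.of_bound 1 ?_
    filter_upwards [hsmall] with ξ hξ
    rw [one_mul, norm_pow, norm_pow, Real.norm_eq_abs, Real.norm_eq_abs,
      abs_of_pos (half_pos hr)]
    exact pow_le_pow_left₀ (abs_nonneg _) hξ.le _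
  exact hO.trans_isLittleO (isLittleO_pow_pow_of_lt_left (by positivity) (by linarith))

end

theorem corollary3p3 (a b : ℝ) (c : ℂ) (hb : 0 < b) (hab : b ≤ a) :
    (∀ (n β γ : ℕ) (_ : 0 < β) (_ : 0 < γ) (A : Matrix (Fin n) (Fin n) ℂ)
        (_ : IsBandedMatrix β γ A) (E : Set ℂ) (_ : IsCompact E)
        (_ : frontier E = horizontalEllipse a b c) (_ : fieldOfValues A ⊆ E) (k l : Fin n),
        b < (bandIndex β γ k l : ℝ) →
          ‖(NormedSpace.exp A) k l‖ ≤ expDecayBound a b c.re (bandIndex β γ k l)) ∧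
      Asymptotics.IsEquivalent Filter.atTop (expDecayBound a b c.re)
        (fun ξ : ℕ => 2 * Real.exp c.re * (Real.exp 1 * ((a + b) / (2 * (ξ : ℝ)))) ^ ξ) ∧
      ∀ r : ℝ, 0 < r →
        Asymptotics.IsLittleO Filter.atTop (expDecayBound a b c.re)
          (fun ξ : ℕ => r ^ ξ) := by
  refine ⟨fun n β γ hβ hγ A hA E hE hf hW k l hξ =>
    norm_exp_apply_le_expDecayBound hb hab hβ hγ hA hE hf hW hξ,
    expDecayBound_isEquivalent c.re hb hab, fun r hr => ?_⟩
  refine (expDecayBound_isEquivalent c.re hb hab).isBigO.trans_isLittleO ?_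
  have h := (pow_const_div_natCast_isLittleO (Real.exp 1 * ((a + b) / 2)) r hr).const_mul_left
    (2 * Real.exp c.re)
  simpa only [mul_div_assoc, div_div] using h
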